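/- Let $0<c<b<a$ and let $P$ be any point of the ellipsoid $$\frac{x^2}{a^2}+\frac{y^2}{b^2}+\frac{z^2}{c^2}=1$$ in Euclidean three-space. Its focal ellipse is the curve $\frac{x^2}{a^2-c^2}+\frac{y^2}{b^2-c^2}=1$, $z=0$, and its focal hyperbola is the curve (with both branches) $\frac{x^2}{a^2-b^2}+\frac{z^2}{c^2-b^2}=1$, $y=0$. Let $F_1=(-\sqrt{a^2-c^2},0,0)$ be the left focus of the focal hyperbola and $G_2=(\sqrt{a^2-b^2},0,0)$ the right focus of the focal ellipse. Then, as $H$ ranges over the focal hyperbola and $E$ over the focal ellipse, the length $$|F_1H|+|HP|+|PE|+|EG_2|$$ of the broken line $F_1HPEG_2$ attains a minimum, and this minimum is equal to $$2a+\sqrt{a^2-c^2}-\sqrt{a^2-b^2}.$$ In particular it does not depend on the position of $P$ on the ellipsoid. -/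

import Mathlib

noncomputable section

namespace Staude

/-- Euclidean three-space. -/
abbrev E3 : Type := EuclideanSpace ℝ (Fin 3)

/-- The ellipsoid `x²/a² + y²/b² + z²/c² = 1`. -/
def ellipsoid (a b c : ℝ) : Set E3 :=
  {p | p 0 ^ 2 / a ^ 2 + p 1 ^ 2 / b ^ 2 + p 2 ^ 2 / c ^ 2 = 1}

/-- The focal ellipse of the ellipsoid: `x²/(a²-c²) + y²/(b²-c²) = 1`, `z = 0`. -/
def focalEllipse (a b c : ℝ) : Set E3 :=
  {p | p 0 ^ 2 / (a ^ 2 - c ^ 2) + p 1 ^ 2 / (b ^ 2 - c ^ 2) = 1 ∧ p 2 = 0}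

/-- The focal hyperbola of the ellipsoid (both branches):
`x²/(a²-b²) + z²/(c²-b²) = 1`, `y = 0`. -/
def focalHyperbola (a b c : ℝ) : Set E3 :=
  {p | p 0 ^ 2 / (a ^ 2 - b ^ 2) + p 2 ^ 2 / (c ^ 2 - b ^ 2) = 1 ∧ p 1 = 0}

/-- The left focus of the focal hyperbola. Its squared semi-axes are `a²-b²` and `b²-c²`, so its
focal distance from the centre is the square root of their sum `a²-c²`. -/
def leftFocusHyperbola (a c : ℝ) : E3 := !₂[-√(a ^ 2 - c ^ 2), 0, 0]

/-- The right focus of the focal ellipse. Its squared semi-axes are `a²-c²` and `b²-c²`, so its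
focal distance from the centre is the square root of their difference `a²-b²`. -/
def rightFocusEllipse (a b : ℝ) : E3 := !₂[√(a ^ 2 - b ^ 2), 0, 0]

/-- The length of the broken line `F H P E G`. -/
def brokenLineLength (F H P E G : E3) : ℝ :=
  dist F H + dist H P + dist P E + dist E G

end Staude

end

/-!
Write `k = √(a² - c²)` and `m = √(a² - b²)`, so that the focal ellipse consists of the points
`(k s, ±√((k² - m²)(1 - s²)), 0)` with `|s| ≤ 1`, and the focal hyperbola of the points
`(m s, 0, ±√((k² - m²)(s² - 1)))` with `1 ≤ |s|`. A point `P` of the ellipsoid has confocal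
coordinates `(a, u, v)`, the semi-axes along the `x`-axis of the three confocal quadrics through it,
with `|v| ≤ m ≤ u ≤ k` and `v` signed so that `x = a u v / (k m)` (`exists_confocalCoordinates`).

The proof rests on two sharp inequalities:
`|F₁H| + |HP| ≥ a + u + v - m` for all `H` on the hyperbola, and
`|PE| + |EG₂| ≥ a - u - v + k` for all `E` on the ellipse.
Each is attained, and the points `H` and `E` are chosen independently, so the minimum of the sum is
`2a + k - m`, in which the coordinates `u` and `v` of `P` have cancelled.

Both come from one identity. The distance from a focus to a point of a focal conic is the modulus
of an affine function of the parameter `s`. For the distance from `P` to the point `Q` of parameter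
`s`, the difference
`|PQ|² - (v₁ + v₂ + v₃ + κ s)²` is, up to the factor `1 / κ`, of the form `α + β ∓ 2√(α β)`, where
`κ` is `k` for the hyperbola and `m` for the ellipse, where `v₁, v₂, v₃` are the coordinates of `P`
with an even number of signs changed, and where `α`, `β` are affine in `s`
(`ConfocalCoordinates.mul_sq_dist_sub`). If `α` and `β` are nonnegative this gives
`|PQ| ≥ |v₁ + v₂ + v₃ + κ s|` (`ConfocalCoordinates.abs_le_sqrt`), with equality for a suitable
point with `α = β` (`ConfocalCoordinates.exists_sqrt_eq`).
-/

namespace Staude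

/-! ### Confocal coordinates and distances to a focal conic -/

/-- The point with coordinates `x, η, ζ` has confocal coordinates `v₁, v₂, v₃`: up to sign, the
semi-axes along the first axis of the confocal quadrics through it. The coordinate `η` is the one
in the plane of the focal conic formed by the points `(μ * s, w)` with
`w ^ 2 = (μ ^ 2 - κ ^ 2) * (1 - s ^ 2)`, whose vertices on the first axis are at `±μ` and whose foci
are at `±κ`: it is an ellipse for `κ < μ` and a hyperbola for `μ < κ`. The coordinate `ζ` is
orthogonal to that plane. The condition `x_eq` makes the product of the signs the sign of `x`. -/
structure ConfocalCoordinates (κ μ v₁ v₂ v₃ x η ζ : ℝ) : Prop where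
  x_eq : x * κ * μ = v₁ * v₂ * v₃
  sq_eq : κ ^ 2 * (μ ^ 2 - κ ^ 2) * η ^ 2 =
    (κ ^ 2 - v₁ ^ 2) * (κ ^ 2 - v₂ ^ 2) * (κ ^ 2 - v₃ ^ 2)
  norm_sq : x ^ 2 + η ^ 2 + ζ ^ 2 = v₁ ^ 2 + v₂ ^ 2 + v₃ ^ 2 - κ ^ 2 - μ ^ 2

namespace ConfocalCoordinates

variable {κ μ v₁ v₂ v₃ x η ζ : ℝ}

/-- Changing the signs of two confocal coordinates does not change the point. -/
theorem neg_right (h : ConfocalCoordinates κ μ v₁ v₂ v₃ x η ζ) :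
    ConfocalCoordinates κ μ v₁ (-v₂) (-v₃) x η ζ :=
  ⟨by linear_combination h.x_eq, by linear_combination h.sq_eq, by linear_combination h.norm_sq⟩

theorem neg_left (h : ConfocalCoordinates κ μ v₁ v₂ v₃ x η ζ) :
    ConfocalCoordinates κ μ (-v₁) (-v₂) v₃ x η ζ :=
  ⟨by linear_combination h.x_eq, by linear_combination h.sq_eq, by linear_combination h.norm_sq⟩

/-- Comparison of the distance to the point of parameter `s` on the focal conic with an affine
function of `s`. -/
theorem mul_sq_dist_sub (h : ConfocalCoordinates κ μ v₁ v₂ v₃ x η ζ) {s w : ℝ}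
    (hw : w ^ 2 = (μ ^ 2 - κ ^ 2) * (1 - s ^ 2)) :
    κ * ((x - μ * s) ^ 2 + (η - w) ^ 2 + ζ ^ 2 - (v₁ + v₂ + v₃ + κ * s) ^ 2) =
      -((1 + s) * ((κ + v₁) * (κ + v₂) * (κ + v₃))) +
        -((1 - s) * ((κ - v₁) * (κ - v₂) * (κ - v₃))) - 2 * (κ * η * w) := by
  linear_combination κ * hw + κ * h.norm_sq - 2 * s * h.x_eq

/-- The mixed term of `mul_sq_dist_sub` is the geometric mean of the two others, up to sign. -/
theorem sq_mul_mul (h : ConfocalCoordinates κ μ v₁ v₂ v₃ x η ζ) {s w : ℝ}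
    (hw : w ^ 2 = (μ ^ 2 - κ ^ 2) * (1 - s ^ 2)) :
    (κ * η * w) ^ 2 = -((1 + s) * ((κ + v₁) * (κ + v₂) * (κ + v₃))) *
        -((1 - s) * ((κ - v₁) * (κ - v₂) * (κ - v₃))) := by
  linear_combination κ ^ 2 * η ^ 2 * hw + (1 - s ^ 2) * h.sq_eq

theorem abs_le_sqrt (h : ConfocalCoordinates κ μ v₁ v₂ v₃ x η ζ) (hκ : 0 < κ) {s w : ℝ}
    (hw : w ^ 2 = (μ ^ 2 - κ ^ 2) * (1 - s ^ 2))
    (hα : (1 + s) * ((κ + v₁) * (κ + v₂) * (κ + v₃)) ≤ 0)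
    (hβ : (1 - s) * ((κ - v₁) * (κ - v₂) * (κ - v₃)) ≤ 0) :
    |v₁ + v₂ + v₃ + κ * s| ≤ √((x - μ * s) ^ 2 + (η - w) ^ 2 + ζ ^ 2) := by
  have h₁ := h.mul_sq_dist_sub hw
  have h₂ := h.sq_mul_mul hw
  set α := -((1 + s) * ((κ + v₁) * (κ + v₂) * (κ + v₃)))
  set β := -((1 - s) * ((κ - v₁) * (κ - v₂) * (κ - v₃)))
  have h₃ : 2 * (κ * η * w) ≤ α + β := by
    refine le_of_sq_le_sq ?_ (by linarith)
    nlinarith [sq_nonneg (α - β)]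
  apply Real.abs_le_sqrt
  rw [← sub_nonneg]
  exact nonneg_of_mul_nonneg_right (by linarith) hκ

theorem exists_sqrt_eq (h : ConfocalCoordinates κ μ v₁ v₂ v₃ x η ζ) (hκ : 0 < κ) {s : ℝ}
    (hs : 0 ≤ (μ ^ 2 - κ ^ 2) * (1 - s ^ 2))
    (hαβ : (1 + s) * ((κ + v₁) * (κ + v₂) * (κ + v₃)) =
      (1 - s) * ((κ - v₁) * (κ - v₂) * (κ - v₃)))
    (hα : (1 + s) * ((κ + v₁) * (κ + v₂) * (κ + v₃)) ≤ 0) :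
    ∃ w, w ^ 2 = (μ ^ 2 - κ ^ 2) * (1 - s ^ 2) ∧
      √((x - μ * s) ^ 2 + (η - w) ^ 2 + ζ ^ 2) = |v₁ + v₂ + v₃ + κ * s| := by
  have hw := Real.sq_sqrt hs
  -- Of the two points `w = ±√(…)` of the conic, the one on the same side as `η` is needed.
  obtain ⟨w, hw, hηw⟩ : ∃ w, w ^ 2 = (μ ^ 2 - κ ^ 2) * (1 - s ^ 2) ∧ 0 ≤ κ * η * w := by
    rcases le_total 0 η with hη | hη
    · exact ⟨_, hw, by positivity⟩
    · exact ⟨_, (neg_sq _).trans hw, by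
        have := mul_nonneg (mul_nonneg hκ.le (neg_nonneg.2 hη))
          (Real.sqrt_nonneg ((μ ^ 2 - κ ^ 2) * (1 - s ^ 2)))
        linarith⟩
  refine ⟨w, hw, ?_⟩
  have h₁ := h.mul_sq_dist_sub hw
  have h₂ := h.sq_mul_mul hw
  rw [← hαβ] at h₁ h₂
  have h₃ : κ * η * w = -((1 + s) * ((κ + v₁) * (κ + v₂) * (κ + v₃))) := by
    rw [← sq_eq_sq₀ hηw (by linarith), h₂, sq]
  rw [← Real.sqrt_sq_eq_abs]
  congr 1
  refine mul_left_cancel₀ hκ.ne' ?_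
  linarith

/-! ### The focal hyperbola -/

/-- A path from the left focus `(-κ, 0)` via the focal hyperbola has length at least
`v₁ + v₂ + v₃ - μ`. -/
theorem hyperbola_le (h : ConfocalCoordinates κ μ v₁ v₂ v₃ x η ζ) (hμ : 0 < μ) (hμκ : μ < κ)
    (h₁ : κ ≤ v₁) (h₂ : μ ≤ v₂) (h₂' : v₂ ≤ κ) (h₃ : |v₃| ≤ μ) {s w : ℝ}
    (hw : w ^ 2 = (μ ^ 2 - κ ^ 2) * (1 - s ^ 2)) :
    v₁ + v₂ + v₃ - μ ≤ |κ * s + μ| + √((x - μ * s) ^ 2 + (η - w) ^ 2 + ζ ^ 2) := by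
  have hκ : 0 < κ := hμ.trans hμκ
  obtain ⟨h₃, h₃'⟩ := abs_le.1 h₃
  have hs : 1 ≤ |s| := by
    rw [← one_le_sq_iff_one_le_abs]
    by_contra! hs
    have : 0 < (κ ^ 2 - μ ^ 2) * (1 - s ^ 2) :=
      mul_pos (by nlinarith) (by linarith)
    nlinarith [sq_nonneg w]
  rcases le_abs'.1 hs with hs | hs
  · have := h.abs_le_sqrt hκ hw
      (mul_nonpos_of_nonpos_of_nonneg (by linarith) (mul_nonneg (mul_nonneg (by linarith)
        (by linarith)) (by linarith)))
      (mul_nonpos_of_nonneg_of_nonpos (by linarith) (mul_nonpos_of_nonpos_of_nonneg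
        (mul_nonpos_of_nonpos_of_nonneg (by linarith) (by linarith)) (by linarith)))
    linarith [le_abs_self (v₁ + v₂ + v₃ + κ * s), neg_abs_le (κ * s + μ)]
  · -- On the right branch the bound is `v₁ + v₂ - v₃ + μ`, which is only larger since `v₃ ≤ μ`.
    have := h.neg_left.abs_le_sqrt hκ hw
      (mul_nonpos_of_nonneg_of_nonpos (by linarith) (mul_nonpos_of_nonpos_of_nonneg
        (mul_nonpos_of_nonpos_of_nonneg (by linarith) (by linarith)) (by linarith)))
      (mul_nonpos_of_nonpos_of_nonneg (by linarith) (mul_nonneg (mul_nonneg (by linarith)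
        (by linarith)) (by linarith)))
    linarith [neg_abs_le (-v₁ + -v₂ + v₃ + κ * s), le_abs_self (κ * s + μ)]

/-- The bound of `hyperbola_le` is attained, by a point of the left branch. -/
theorem exists_hyperbola_eq (h : ConfocalCoordinates κ μ v₁ v₂ v₃ x η ζ) (hμ : 0 < μ)
    (hμκ : μ < κ) (h₁ : κ ≤ v₁) (h₂ : μ ≤ v₂) (h₂' : v₂ ≤ κ) (h₃ : |v₃| ≤ μ) :
    ∃ s w, w ^ 2 = (μ ^ 2 - κ ^ 2) * (1 - s ^ 2) ∧
      |κ * s + μ| + √((x - μ * s) ^ 2 + (η - w) ^ 2 + ζ ^ 2) = v₁ + v₂ + v₃ - μ := by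
  have hκ : 0 < κ := hμ.trans hμκ
  obtain ⟨h₃, h₃'⟩ := abs_le.1 h₃
  have hα : 0 ≤ (κ + v₁) * (κ + v₂) * (κ + v₃) :=
    mul_nonneg (mul_nonneg (by linarith) (by linarith)) (by linarith)
  have hβ : (κ - v₁) * (κ - v₂) * (κ - v₃) ≤ 0 := mul_nonpos_of_nonpos_of_nonneg
    (mul_nonpos_of_nonpos_of_nonneg (by linarith) (by linarith)) (by linarith)
  have hd : 0 < κ ^ 2 + (v₁ * v₂ + v₁ * v₃ + v₂ * v₃) := by
    have := mul_nonneg (by linarith : 0 ≤ v₁ - μ) (by linarith : 0 ≤ v₂ - μ)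
    have := mul_nonneg (by linarith : 0 ≤ v₁ + v₂) (by linarith : 0 ≤ v₃ + μ)
    nlinarith
  -- The value of `s` for which the two terms of `abs_le_sqrt` are equal.
  obtain ⟨s, hs⟩ : ∃ s, s * (κ * (κ ^ 2 + (v₁ * v₂ + v₁ * v₃ + v₂ * v₃))) =
      -(κ ^ 2 * (v₁ + v₂ + v₃) + v₁ * v₂ * v₃) :=
    ⟨_, div_mul_cancel₀ _ (mul_pos hκ hd).ne'⟩
  have hαβ : (1 + s) * ((κ + v₁) * (κ + v₂) * (κ + v₃)) =
      (1 - s) * ((κ - v₁) * (κ - v₂) * (κ - v₃)) := by linear_combination 2 * hs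
  have hs₁ : s ≤ -1 := by
    have hD := mul_pos hκ hd
    have : (s + 1) * (κ * (κ ^ 2 + (v₁ * v₂ + v₁ * v₃ + v₂ * v₃))) ≤ 0 := by linarith
    linarith [nonpos_of_mul_nonpos_left this hD]
  obtain ⟨w, hw, hdist⟩ := h.exists_sqrt_eq hκ (s := s)
    (mul_nonneg_of_nonpos_of_nonpos (by nlinarith) (by nlinarith)) hαβ
    (mul_nonpos_of_nonpos_of_nonneg (by linarith) hα)
  have hpos : 0 ≤ v₁ + v₂ + v₃ + κ * s := by
    refine nonneg_of_mul_nonneg_left (b := κ ^ 2 + (v₁ * v₂ + v₁ * v₃ + v₂ * v₃)) ?_ hd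
    have : (v₁ + v₂ + v₃ + κ * s) * (κ ^ 2 + (v₁ * v₂ + v₁ * v₃ + v₂ * v₃)) =
      (v₁ + v₂) * (v₁ + v₃) * (v₂ + v₃) := by linear_combination hs
    rw [this]
    exact mul_nonneg (mul_nonneg (by linarith) (by linarith)) (by linarith)
  refine ⟨s, w, hw, ?_⟩
  rw [hdist, abs_of_nonneg hpos, abs_of_nonpos (by nlinarith)]
  ring

/-! ### The focal ellipse -/

/-- A path via the focal ellipse to its right focus `(κ, 0)` has length at least
`v₁ - v₂ - v₃ + μ`. -/
theorem ellipse_le (h : ConfocalCoordinates κ μ v₁ v₂ v₃ x η ζ) (hκ : 0 < κ) (hκμ : κ < μ)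
    (h₁ : μ ≤ v₁) (h₂ : κ ≤ v₂) (h₃ : |v₃| ≤ κ) {s w : ℝ}
    (hw : w ^ 2 = (μ ^ 2 - κ ^ 2) * (1 - s ^ 2)) :
    v₁ - v₂ - v₃ + μ ≤ √((x - μ * s) ^ 2 + (η - w) ^ 2 + ζ ^ 2) + |μ - κ * s| := by
  obtain ⟨h₃, h₃'⟩ := abs_le.1 h₃
  have hs : |s| ≤ 1 := by
    rw [← sq_le_one_iff_abs_le_one]
    by_contra! hs
    have : 0 < (μ ^ 2 - κ ^ 2) * (s ^ 2 - 1) :=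
      mul_pos (by nlinarith) (by linarith)
    nlinarith [sq_nonneg w]
  obtain ⟨hs, hs'⟩ := abs_le.1 hs
  have := h.neg_right.abs_le_sqrt hκ hw
    (mul_nonpos_of_nonneg_of_nonpos (by linarith) (mul_nonpos_of_nonpos_of_nonneg
      (mul_nonpos_of_nonneg_of_nonpos (by linarith) (by linarith)) (by linarith)))
    (mul_nonpos_of_nonneg_of_nonpos (by linarith) (mul_nonpos_of_nonpos_of_nonneg
      (mul_nonpos_of_nonpos_of_nonneg (by linarith) (by linarith)) (by linarith)))
  linarith [le_abs_self (v₁ + -v₂ + -v₃ + κ * s), le_abs_self (μ - κ * s)]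

/-- The bound of `ellipse_le` is attained. -/
theorem exists_ellipse_eq (h : ConfocalCoordinates κ μ v₁ v₂ v₃ x η ζ) (hκ : 0 < κ) (hκμ : κ < μ)
    (h₁ : μ ≤ v₁) (h₂ : κ ≤ v₂) (h₂' : v₂ ≤ μ) (h₃ : |v₃| ≤ κ) :
    ∃ s w, w ^ 2 = (μ ^ 2 - κ ^ 2) * (1 - s ^ 2) ∧
      √((x - μ * s) ^ 2 + (η - w) ^ 2 + ζ ^ 2) + |μ - κ * s| = v₁ - v₂ - v₃ + μ := by
  obtain ⟨h₃, h₃'⟩ := abs_le.1 h₃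
  have hα : (κ + v₁) * (κ + -v₂) * (κ + -v₃) ≤ 0 := mul_nonpos_of_nonpos_of_nonneg
    (mul_nonpos_of_nonneg_of_nonpos (by linarith) (by linarith)) (by linarith)
  have hβ : (κ - v₁) * (κ - -v₂) * (κ - -v₃) ≤ 0 := mul_nonpos_of_nonpos_of_nonneg
    (mul_nonpos_of_nonpos_of_nonneg (by linarith) (by linarith)) (by linarith)
  -- The value of `s` for which the two terms of `abs_le_sqrt` are equal. In the second case both
  -- vanish identically: `v₂ = κ` and `v₃ = -κ`, so `P` is an umbilic, and any `s` will do.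
  obtain ⟨s, hs, hs', hαβ, hpos⟩ : ∃ s, -1 ≤ s ∧ s ≤ 1 ∧
      (1 + s) * ((κ + v₁) * (κ + -v₂) * (κ + -v₃)) =
        (1 - s) * ((κ - v₁) * (κ - -v₂) * (κ - -v₃)) ∧
      0 ≤ v₁ + -v₂ + -v₃ + κ * s := by
    set e := v₁ * v₂ + v₁ * v₃ - v₂ * v₃ - κ ^ 2 with he
    -- `-2 * κ * e` is the sum of the products in `hα` and `hβ`.
    have hd : 0 ≤ κ * e := by rw [he]; linarith
    rcases (nonneg_of_mul_nonneg_right hd hκ).lt_or_eq with hd | hd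
    · obtain ⟨s, hs⟩ : ∃ s, s * (κ * e) = κ ^ 2 * (v₁ - v₂ - v₃) + v₁ * v₂ * v₃ :=
        ⟨_, div_mul_cancel₀ _ (mul_pos hκ hd).ne'⟩
      have hD := mul_pos hκ hd
      refine ⟨s, ?_, ?_, ?_, ?_⟩
      · have : 0 ≤ (1 + s) * (κ * e) := by rw [add_mul, hs, he]; linarith
        linarith [nonneg_of_mul_nonneg_left this hD]
      · have : 0 ≤ (1 - s) * (κ * e) := by rw [sub_mul, hs, he]; linarith
        linarith [nonneg_of_mul_nonneg_left this hD]
      · rw [he] at hs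
        linear_combination -2 * hs
      · refine nonneg_of_mul_nonneg_left (b := e) ?_ hd
        have : (v₁ + -v₂ + -v₃ + κ * s) * e = (v₁ - v₂) * (v₁ - v₃) * (v₂ + v₃) := by
          rw [he] at hs ⊢
          linear_combination hs
        rw [this]
        exact mul_nonneg (mul_nonneg (by linarith) (by linarith)) (by linarith)
    · have hz : κ * e = 0 := by rw [← hd, mul_zero]
      rw [he] at hz
      refine ⟨1, by norm_num, le_rfl, ?_, by linarith⟩
      linarith
  obtain ⟨w, hw, hdist⟩ := h.neg_right.exists_sqrt_eq hκ (s := s)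
    (mul_nonneg (by nlinarith) (by nlinarith)) hαβ
    (mul_nonpos_of_nonneg_of_nonpos (by linarith) hα)
  refine ⟨s, w, hw, ?_⟩
  rw [hdist, abs_of_nonneg hpos, abs_of_nonneg (by nlinarith)]
  ring

end ConfocalCoordinates

/-! ### Points of the ellipsoid -/

/-- For `P` on the ellipsoid, `u ^ 2` and `v ^ 2` are the roots of a quadratic polynomial that is
nonnegative at `0`, nonpositive at `m ^ 2` and nonnegative at `k ^ 2`. -/
theorem exists_confocalCoordinates {a k m x y z : ℝ} (hm : 0 < m) (hmk : m < k) (hka : k < a)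
    (h : x ^ 2 / a ^ 2 + y ^ 2 / (a ^ 2 - m ^ 2) + z ^ 2 / (a ^ 2 - k ^ 2) = 1) :
    ∃ u v, m ≤ u ∧ u ≤ k ∧ |v| ≤ m ∧ ConfocalCoordinates k m a u v x z y ∧
      ConfocalCoordinates m k a u v x y z := by
  have hk : 0 < k := hm.trans hmk
  have ha : 0 < a := hk.trans hka
  have hm2 : 0 < m ^ 2 := by positivity
  have hmk2 : 0 < k ^ 2 - m ^ 2 := by nlinarith
  have hc : 0 < a ^ 2 - k ^ 2 := by nlinarith
  have hb : 0 < a ^ 2 - m ^ 2 := by linarith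
  obtain ⟨X, hX⟩ : ∃ X, X = x ^ 2 / a ^ 2 := ⟨_, rfl⟩
  obtain ⟨Y, hY⟩ : ∃ Y, Y = y ^ 2 / (a ^ 2 - m ^ 2) := ⟨_, rfl⟩
  obtain ⟨Z, hZ⟩ : ∃ Z, Z = z ^ 2 / (a ^ 2 - k ^ 2) := ⟨_, rfl⟩
  rw [← hX, ← hY, ← hZ] at h
  have hX0 : 0 ≤ X := by rw [hX]; positivity
  have hY0 : 0 ≤ Y := by rw [hY]; positivity
  have hZ0 : 0 ≤ Z := by rw [hZ]; positivity
  rw [eq_div_iff (by positivity)] at hX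
  rw [eq_div_iff hb.ne'] at hY
  rw [eq_div_iff hc.ne'] at hZ
  obtain ⟨S, hS⟩ : ∃ S, S = x ^ 2 + y ^ 2 + z ^ 2 + k ^ 2 + m ^ 2 - a ^ 2 := ⟨_, rfl⟩
  have hqm : m ^ 2 * m ^ 2 - S * m ^ 2 + k ^ 2 * m ^ 2 * X = -(m ^ 2 * (k ^ 2 - m ^ 2) * Y) := by
    rw [hS]; linear_combination m ^ 2 * hX + m ^ 2 * hY + m ^ 2 * hZ - m ^ 2 * (a ^ 2 - k ^ 2) * h
  have hqk : k ^ 2 * k ^ 2 - S * k ^ 2 + k ^ 2 * m ^ 2 * X = k ^ 2 * (k ^ 2 - m ^ 2) * Z := by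
    rw [hS]; linear_combination k ^ 2 * hX + k ^ 2 * hY + k ^ 2 * hZ - k ^ 2 * (a ^ 2 - m ^ 2) * h
  have hYm : 0 ≤ m ^ 2 * (k ^ 2 - m ^ 2) * Y := by positivity
  have hZk : 0 ≤ k ^ 2 * (k ^ 2 - m ^ 2) * Z := by positivity
  have hD : 0 ≤ S ^ 2 - 4 * (k ^ 2 * m ^ 2 * X) := by nlinarith [sq_nonneg (2 * m ^ 2 - S)]
  obtain ⟨α, β, hαβ, hsum, hprod⟩ : ∃ α β, β ≤ α ∧ α + β = S ∧ α * β = k ^ 2 * m ^ 2 * X := by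
    refine ⟨(S + √(S ^ 2 - 4 * (k ^ 2 * m ^ 2 * X))) / 2,
      (S - √(S ^ 2 - 4 * (k ^ 2 * m ^ 2 * X))) / 2, ?_, by ring, ?_⟩
    · linarith [Real.sqrt_nonneg (S ^ 2 - 4 * (k ^ 2 * m ^ 2 * X))]
    · linear_combination -(1 / 4) * Real.sq_sqrt hD
  have hfm : (m ^ 2 - α) * (m ^ 2 - β) = -(m ^ 2 * (k ^ 2 - m ^ 2) * Y) := by
    rw [← hqm, ← hsum, ← hprod]; ring
  have hfk : (k ^ 2 - α) * (k ^ 2 - β) = k ^ 2 * (k ^ 2 - m ^ 2) * Z := by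
    rw [← hqk, ← hsum, ← hprod]; ring
  have hmα : m ^ 2 ≤ α := by
    by_contra! hlt
    nlinarith [mul_pos (sub_pos.2 hlt) (sub_pos.2 (hαβ.trans_lt hlt))]
  have hβm : β ≤ m ^ 2 := by
    by_contra! hlt
    nlinarith [mul_pos (sub_pos.2 hlt) (sub_pos.2 (hlt.trans_le hαβ))]
  have hαk : α ≤ k ^ 2 := by
    have : 0 ≤ (k ^ 2 - α) * (k ^ 2 - β) := hfk ▸ hZk
    linarith [nonneg_of_mul_nonneg_left this (by linarith)]
  have hα : 0 < α := hm2.trans_le hmα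
  have hu : √α ^ 2 = α := Real.sq_sqrt hα.le
  have hu0 : 0 < √α := Real.sqrt_pos.2 hα
  obtain ⟨v, hv⟩ : ∃ v, v * (a * √α) = x * k * m := ⟨_, div_mul_cancel₀ _ (by positivity)⟩
  have hv2 : v ^ 2 = β := by
    refine mul_right_cancel₀ (b := a ^ 2 * α) (by positivity) ?_
    have : (v * (a * √α)) ^ 2 = (x * k * m) ^ 2 := by rw [hv]
    linear_combination this - v ^ 2 * a ^ 2 * hu - a ^ 2 * hprod - k ^ 2 * m ^ 2 * hX
  refine ⟨√α, v, Real.le_sqrt_of_sq_le hmα, Real.sqrt_le_iff.2 ⟨hk.le, hαk⟩,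
    abs_le_of_sq_le_sq (hv2 ▸ hβm) hm.le, ⟨by linear_combination -hv, ?_, ?_⟩,
    ⟨by linear_combination -hv, ?_, ?_⟩⟩ <;> rw [hu, hv2]
  · linear_combination (k ^ 2 - a ^ 2) * (-hfk) + k ^ 2 * (k ^ 2 - m ^ 2) * hZ
  · linear_combination -hsum - hS
  · linear_combination (m ^ 2 - a ^ 2) * (-hfm) - m ^ 2 * (k ^ 2 - m ^ 2) * hY
  · linear_combination -hsum - hS

theorem dist_eq_sqrt (p q : E3) :
    dist p q = √((p 0 - q 0) ^ 2 + (p 1 - q 1) ^ 2 + (p 2 - q 2) ^ 2) := by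
  simp [EuclideanSpace.dist_eq, Fin.sum_univ_three, Real.dist_eq, sq_abs]

end Staude

theorem mainTheorem2 (a b c : ℝ) (hc : 0 < c) (hcb : c < b) (hba : b < a)
    (P : Staude.E3) (hP : P ∈ Staude.ellipsoid a b c) :
    IsLeast
      {L : ℝ | ∃ H ∈ Staude.focalHyperbola a b c, ∃ E ∈ Staude.focalEllipse a b c,
        L = Staude.brokenLineLength (Staude.leftFocusHyperbola a c) H P E
          (Staude.rightFocusEllipse a b)}
      (2 * a + √(a ^ 2 - c ^ 2) - √(a ^ 2 - b ^ 2)) := by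
  have hb : 0 < b := hc.trans hcb
  have ha : 0 < a := hb.trans hba
  have hm2 : 0 < a ^ 2 - b ^ 2 := by nlinarith
  have hk2 : 0 < b ^ 2 - c ^ 2 := by nlinarith
  simp only [Staude.ellipsoid, Staude.focalHyperbola, Staude.focalEllipse,
    Staude.brokenLineLength, Staude.leftFocusHyperbola, Staude.rightFocusEllipse,
    Set.mem_ofPred_eq, Staude.dist_eq_sqrt] at hP ⊢
  have hm := Real.sqrt_pos.2 hm2
  have hmk := Real.sqrt_lt_sqrt hm2.le (by linarith : a ^ 2 - b ^ 2 < a ^ 2 - c ^ 2)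
  have hm_sq := Real.sq_sqrt hm2.le
  have hk_sq := Real.sq_sqrt (by linarith : 0 ≤ a ^ 2 - c ^ 2)
  set m := √(a ^ 2 - b ^ 2)
  set k := √(a ^ 2 - c ^ 2)
  have hk : 0 < k := hm.trans hmk
  have hka : k < a := lt_of_pow_lt_pow_left₀ 2 ha.le (by rw [hk_sq]; linarith [pow_pos hc 2])
  have hb2 : b ^ 2 = a ^ 2 - m ^ 2 := by linarith
  have hc2 : c ^ 2 = a ^ 2 - k ^ 2 := by linarith
  have hcb2 : c ^ 2 - b ^ 2 = m ^ 2 - k ^ 2 := by linarith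
  have hbc2 : b ^ 2 - c ^ 2 = k ^ 2 - m ^ 2 := by linarith
  have hmk2 : 0 < k ^ 2 - m ^ 2 := by linarith
  rw [← hm_sq, ← hk_sq, hcb2, hbc2]
  obtain ⟨u, v, hmu, huk, hv, hz, hy⟩ :=
    Staude.exists_confocalCoordinates hm hmk hka (hb2 ▸ hc2 ▸ hP)
  -- Distances from the foci to points of the focal conics, in terms of the parameter `s`.
  have hF : ∀ s w : ℝ, w ^ 2 = (m ^ 2 - k ^ 2) * (1 - s ^ 2) →
      √((-k - m * s) ^ 2 + (0 - 0) ^ 2 + (0 - w) ^ 2) = |k * s + m| := fun s w hw => by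
    rw [← Real.sqrt_sq_eq_abs]
    congr 1
    linear_combination hw
  have hG : ∀ s w : ℝ, w ^ 2 = (k ^ 2 - m ^ 2) * (1 - s ^ 2) →
      √((k * s - m) ^ 2 + (w - 0) ^ 2 + (0 - 0) ^ 2) = |k - m * s| := fun s w hw => by
    rw [← Real.sqrt_sq_eq_abs]
    congr 1
    linear_combination hw
  constructor
  · obtain ⟨s, w, hw, hs⟩ := hz.exists_hyperbola_eq hm hmk hka.le hmu huk hv
    obtain ⟨t, w', hw', ht⟩ := hy.exists_ellipse_eq hm hmk hka.le hmu huk hv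
    have hne : m ^ 2 - k ^ 2 ≠ 0 := by linarith
    refine ⟨!₂[m * s, 0, w], ⟨?_, by simp⟩, !₂[k * t, w', 0], ⟨?_, by simp⟩, ?_⟩
    · simp only [Matrix.cons_val]
      rw [hw]
      field_simp
      ring
    · simp only [Matrix.cons_val]
      rw [hw']
      field_simp
      ring
    · simp only [Matrix.cons_val]
      rw [hF s w hw, hG t w' hw']
      have h₁ : (m * s - P 0) ^ 2 + (0 - P 1) ^ 2 + (w - P 2) ^ 2 =
        (P 0 - m * s) ^ 2 + (P 2 - w) ^ 2 + P 1 ^ 2 := by ring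
      have h₂ : (P 0 - k * t) ^ 2 + (P 1 - w') ^ 2 + (P 2 - 0) ^ 2 =
        (P 0 - k * t) ^ 2 + (P 1 - w') ^ 2 + P 2 ^ 2 := by ring
      rw [h₁, h₂]
      linarith
  · rintro _ ⟨H, ⟨hH, hH1⟩, E, ⟨hE, hE2⟩, rfl⟩
    obtain ⟨s, hs⟩ : ∃ s, H 0 = m * s := ⟨_, (mul_div_cancel₀ _ hm.ne').symm⟩
    obtain ⟨t, ht⟩ : ∃ t, E 0 = k * t := ⟨_, (mul_div_cancel₀ _ hk.ne').symm⟩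
    have hne : m ^ 2 - k ^ 2 ≠ 0 := by linarith
    have hw : H 2 ^ 2 = (m ^ 2 - k ^ 2) * (1 - s ^ 2) := by
      rw [hs] at hH
      field_simp at hH
      linear_combination hH
    have hw' : E 1 ^ 2 = (k ^ 2 - m ^ 2) * (1 - t ^ 2) := by
      rw [ht] at hE
      field_simp at hE
      linear_combination hE
    have h₁ := hz.hyperbola_le hm hmk hka.le hmu huk hv hw
    have h₂ := hy.ellipse_le hm hmk hka.le hmu hv hw'
    simp only [Matrix.cons_val]
    rw [hs, hH1, ht, hE2, hF s _ hw, hG t _ hw']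
    have h₃ : (m * s - P 0) ^ 2 + (0 - P 1) ^ 2 + (H 2 - P 2) ^ 2 =
      (P 0 - m * s) ^ 2 + (P 2 - H 2) ^ 2 + P 1 ^ 2 := by ring
    have h₄ : (P 0 - k * t) ^ 2 + (P 1 - E 1) ^ 2 + (P 2 - 0) ^ 2 =
      (P 0 - k * t) ^ 2 + (P 1 - E 1) ^ 2 + P 2 ^ 2 := by ring
    rw [h₃, h₄]
    linarith
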